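/- Words are over the alphabet $\Sigma=\{0,1,\sharp\}$. An enumeration problem is given by a binary predicate $A\subseteq\Sigma^*\times\Sigma^*$ such that $A(x)=\{y : A(x,y)\}$ is finite for every $x$ (no bound on the complexity of $A$ is required). The computational model is the random access machine over the integers with addition, subtraction and multiplication, indirect addressing, conditional jumps, and output registers whose content is produced by an output instruction; every instruction costs $O(1)$, except the arithmetic ones, whose cost is linear in the bit size of their operands. A machine solves $A$ if on every input $x$ it produces every element of $A(x)$ exactly once and nothing else, and stops, immediately after the last output instruction if there is one. Let $T(x,i)$ be the cost of the instructions executed before the $i$-th output instruction (the cost of the whole run if nothing is output). The problem $A$ is in $\mathrm{OutputP}^F$ if some machine solves it and, for some polynomial $p$, satisfies $T(x,|A(x)|)<p(|x|,|A(x)|)$ for all $x$. It is in $\mathrm{IncP}^F_a$ if some machine solves it and there are a polynomial $q$ (bounding a precomputation step) and constants $b,c$ such that $T(x,m)\le q(|x|)+c\,m^a|x|^b$ for all $x$ and all $m\le|A(x)|$; put $\mathrm{IncP}^F=\bigcup_{a\ge1}\mathrm{IncP}^F_a$. **Proposition.** $\mathrm{IncP}^F\neq\mathrm{OutputP}^F$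 (unconditionally). -/

import Mathlib

namespace EnumRAM

/-- The alphabet `{0, 1, ♯}`. -/
inductive Letter where
  | zero
  | one
  | sharp

/-- Finite words over the alphabet. -/
abbrev Word := List Letter

/-- The integer that represents a letter in a register; `3` represents the blank. -/
def encode : Option Letter → ℤ
  | some Letter.zero => 0
  | some Letter.one => 1
  | some Letter.sharp => 2
  | none => 3

/-- The letter represented by an integer; every integer other than `0, 1, 2` is a blank. -/
def decode (z : ℤ) : Option Letter :=
  if z = 0 then some Letter.zero
  else if z = 1 then some Letter.one
  else if z = 2 then some Letter.sharp
  else none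

/-- Instructions of the random access machine. The arguments `d a b s r` are indices of work
registers, `l` is a position in the program. -/
inductive Instr where
  /-- `R_d := z` -/
  | const (d : ℕ) (z : ℤ)
  /-- `R_d := R_s` -/
  | copy (d s : ℕ)
  /-- `R_d := R_a + R_b` -/
  | add (d a b : ℕ)
  /-- `R_d := R_a - R_b` -/
  | sub (d a b : ℕ)
  /-- `R_d := R_a * R_b` -/
  | mul (d a b : ℕ)
  /-- `R_d := R_{R_a}` -/
  | load (d a : ℕ)
  /-- `R_{R_a} := R_s` -/
  | store (a s : ℕ)
  /-- `R_d :=` (code of) the letter of the input word at position `R_a` (counted from 0), and the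
  code of the blank beyond the end of the input word -/
  | read (d a : ℕ)
  /-- output register number `R_a` `:=` the letter (or blank) whose code is `R_s` -/
  | write (a s : ℕ)
  /-- go to `l` -/
  | jump (l : ℕ)
  /-- if `R_r = 0` go to `l` -/
  | jumpZero (r l : ℕ)
  /-- if `R_r > 0` go to `l` -/
  | jumpPos (r l : ℕ)
  /-- produce the content of the output registers -/
  | output
  /-- stop -/
  | halt

/-- Is this the instruction `output`? -/
def Instr.isOutput : Instr → Bool
  | Instr.output => true
  | _ => false

/-- Is this the instruction `halt`? -/
def Instr.isHalt : Instr → Bool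
  | Instr.halt => true
  | _ => false

/-- A machine is a finite program. -/
abbrev Machine := List Instr

/-- A configuration: the program counter, the work registers (holding integers) and the output
registers (each holding a letter or a blank). -/
structure Config where
  pc : ℕ
  reg : ℕ → ℤ
  out : ℕ → Option Letter

/-- Initially the work registers hold `0` and the output registers are blank. -/
def Config.init : Config where
  pc := 0
  reg := fun _ => 0
  out := fun _ => none

/-- The content of the output registers: the letters before the first blank. -/
noncomputable def Config.word (c : Config) : Word :=
  (List.range (sInf {i : ℕ | c.out i = none})).filterMap c.out

/-- The instruction to be executed next; leaving the program means to stop. -/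
def Machine.fetch (M : Machine) (c : Config) : Instr :=
  M.getD c.pc Instr.halt

/-- Set work register `d` to `z` and go to the next instruction. -/
def Config.assign (c : Config) (d : ℕ) (z : ℤ) : Config :=
  { c with pc := c.pc + 1, reg := Function.update c.reg d z }

/-- The effect of one instruction on input `x`. A negative number used as an address
counts as the address `0`. -/
def Instr.exec (x : Word) (c : Config) : Instr → Config
  | Instr.const d z => c.assign d z
  | Instr.copy d s => c.assign d (c.reg s)
  | Instr.add d a b => c.assign d (c.reg a + c.reg b)
  | Instr.sub d a b => c.assign d (c.reg a - c.reg b)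
  | Instr.mul d a b => c.assign d (c.reg a * c.reg b)
  | Instr.load d a => c.assign d (c.reg (c.reg a).toNat)
  | Instr.store a s => c.assign (c.reg a).toNat (c.reg s)
  | Instr.read d a => c.assign d (encode x[(c.reg a).toNat]?)
  | Instr.write a s =>
      { c with
        pc := c.pc + 1
        out := Function.update c.out (c.reg a).toNat (decode (c.reg s)) }
  | Instr.jump l => { c with pc := l }
  | Instr.jumpZero r l => { c with pc := if c.reg r = 0 then l else c.pc + 1 }
  | Instr.jumpPos r l => { c with pc := if 0 < c.reg r then l else c.pc + 1 }
  | Instr.output => { c with pc := c.pc + 1 }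
  | Instr.halt => c

/-- The size of an integer: the number of binary digits of its absolute value. -/
def bitSize (z : ℤ) : ℕ := Nat.size z.natAbs

/-- The cost of an instruction: linear in the size of the operands for the arithmetic operations
and constant for all the others (nothing for stopping). -/
def Instr.cost (c : Config) : Instr → ℕ
  | Instr.add _ a b => 1 + bitSize (c.reg a) + bitSize (c.reg b)
  | Instr.sub _ a b => 1 + bitSize (c.reg a) + bitSize (c.reg b)
  | Instr.mul _ a b => 1 + bitSize (c.reg a) + bitSize (c.reg b)
  | Instr.halt => 0
  | _ => 1

namespace Machine

/-- The configuration of `M` on input `x` after `t` steps. -/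
def conf (M : Machine) (x : Word) (t : ℕ) : Config :=
  (fun c => (M.fetch c).exec x c)^[t] Config.init

/-- The instruction executed in step `t` (counted from 0) of the run of `M` on `x`. -/
def instrAt (M : Machine) (x : Word) (t : ℕ) : Instr :=
  M.fetch (M.conf x t)

/-- `M` stops on input `x`. -/
def Halts (M : Machine) (x : Word) : Prop :=
  ∃ t, (M.instrAt x t).isHalt = true

/-- The number of instructions that `M` executes on input `x` before it stops. -/
noncomputable def runLength (M : Machine) (x : Word) : ℕ :=
  sInf {t : ℕ | (M.instrAt x t).isHalt = true}

/-- The number of `output` instructions among the first `t` steps of `M` on `x`. -/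
def numOutputs (M : Machine) (x : Word) (t : ℕ) : ℕ :=
  Nat.count (fun s => (M.instrAt x s).isOutput = true) t

/-- The sequence of words that `M` produces on input `x`. -/
noncomputable def outputs (M : Machine) (x : Word) : List Word :=
  ((List.range (M.runLength x)).filter (fun t => (M.instrAt x t).isOutput)).map
    (fun t => (M.conf x t).word)

/-- `T(M, x, i)`: the sum of the costs of the instructions executed before the `i`-th `output`
instruction. If the run has no `output` instruction at all, it is the cost of the whole run. -/
noncomputable def T (M : Machine) (x : Word) (i : ℕ) : ℕ :=
  if M.outputs x = [] then
    ∑ t ∈ Finset.range (M.runLength x), (M.instrAt x t).cost (M.conf x t)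
  else
    ∑ t ∈ (Finset.range (M.runLength x)).filter (fun t => M.numOutputs x (t + 1) < i),
      (M.instrAt x t).cost (M.conf x t)

end Machine

/-- A binary predicate `A(x, y)`, given as the map `x ↦ A(x) = {y | A(x, y)}`, i.e. as the
enumeration problem itself. -/
abbrev EnumProblem := Word → Set Word

/-- The problems with finitely many solutions on every instance. -/
def EnumF : Set EnumProblem :=
  {A | ∀ x, (A x).Finite}

/-- `M` solves `A`: on every input `x` it stops, it produces every element of `A(x)` exactly once
and nothing else, and it stops immediately after the last `output` instruction. -/
def Solves (M : Machine) (A : EnumProblem) : Prop :=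
  ∀ x : Word,
    M.Halts x ∧
    (M.outputs x).Nodup ∧
    {y | y ∈ M.outputs x} = A x ∧
    (M.outputs x ≠ [] → (M.instrAt x (M.runLength x - 1)).isOutput = true)

/-- Output polynomial time, for problems with finite solution sets. -/
def OutputPF : Set EnumProblem :=
  {A | A ∈ EnumF ∧ ∃ (M : Machine) (p : MvPolynomial (Fin 2) ℕ), Solves M A ∧
    ∀ x : Word, M.T x (A x).ncard < MvPolynomial.eval ![x.length, (A x).ncard] p}

/-- Incremental time `c mᵃ nᵇ`, after a precomputation step of time polynomial in `n`, for
problems with finite solution sets. -/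
def IncPaF (a : ℕ) : Set EnumProblem :=
  {A | A ∈ EnumF ∧ ∃ (M : Machine) (q : Polynomial ℕ) (b c : ℕ), Solves M A ∧
    ∀ (x : Word) (m : ℕ), m ≤ (A x).ncard →
      M.T x m ≤ q.eval x.length + c * m ^ a * x.length ^ b}

/-- Incremental polynomial time, for problems with finite solution sets. -/
def IncPF : Set EnumProblem :=
  ⋃ (a : ℕ) (_ : 1 ≤ a), IncPaF a

end EnumRAM

/-! The separation uses only the length of the solutions. On inputs of length `n`, `longUnary` has
`2^n` solutions, each of length at least `2^n`. A step writes at most one letter and costs at least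
1, so the first output costs at least `2^n` (`Machine.le_T_one`). An incremental bound at `m = 1` is
`q(n) + c * n^b`, whatever `a` is, and so fails for some `n`. Output polynomial time may depend on
the number `2^n` of solutions. Each solution extends the previous one by a single letter, so listing
them all takes `O(2^n)` instructions on integers of `O(n)` bits (`longUnaryMachine_spec`). -/

namespace EnumRAM

/-! ### Composable runs with their outputs and cost bounds -/

/-- `Runs M x c t L k c'`: in `t` steps, none of which is `halt`, the machine `M` on input `x` goes
from the configuration `c` to `c'`, producing the words in `L`, at cost at most `k`. -/
inductive Runs (M : Machine) (x : Word) : Config → ℕ → List Word → ℕ → Config → Prop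
  | refl (c : Config) (k : ℕ) : Runs M x c 0 [] k c
  | step {c : Config} {t : ℕ} {L : List Word} {k j : ℕ} {c' : Config}
      (hh : (M.fetch c).isHalt = false) (hc : (M.fetch c).cost c ≤ j)
      (h : Runs M x ((M.fetch c).exec x c) t L k c') :
      Runs M x c (t + 1) ((if (M.fetch c).isOutput then [c.word] else []) ++ L) (j + k) c'

namespace Runs

variable {M : Machine} {x : Word}

theorem mono {c c' : Config} {t k k' : ℕ} {L : List Word} (h : Runs M x c t L k c')
    (hk : k ≤ k') : Runs M x c t L k' c' := by
  induction h generalizing k' with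
  | refl c k => exact refl c k'
  | @step c t L k j c' hh hc h ih =>
    obtain ⟨d, rfl⟩ := Nat.exists_eq_add_of_le hk
    rw [Nat.add_assoc]
    exact step hh hc (ih (Nat.le_add_right k d))

theorem trans {c c' c'' : Config} {t t' k k' : ℕ} {L L' : List Word}
    (h : Runs M x c t L k c') (h' : Runs M x c' t' L' k' c'') :
    Runs M x c (t + t') (L ++ L') (k + k') c'' := by
  induction h with
  | refl c k => simpa using h'.mono (Nat.le_add_left k' k)
  | step hh hc h ih =>
    rw [List.append_assoc, Nat.add_right_comm, Nat.add_assoc _ _ k']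
    exact step hh hc (ih h')

/-- A step whose instruction is not `output`. -/
theorem silent {c c' d : Config} {t k j : ℕ} {L : List Word} (i : Instr) (hi : M.fetch c = i)
    (hh : i.isHalt = false) (ho : i.isOutput = false) (hc : i.cost c ≤ j) (hd : i.exec x c = d)
    (h : Runs M x d t L k c') : Runs M x c (t + 1) L (j + k) c' := by
  subst hi hd
  simpa [ho] using step hh hc h

/-- A step whose instruction is `output`. -/
theorem produce {c c' : Config} {t k j : ℕ} {L : List Word} (hi : M.fetch c = Instr.output)
    (hj : 1 ≤ j) (h : Runs M x { c with pc := c.pc + 1 } t L k c') :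
    Runs M x c (t + 1) (c.word :: L) (j + k) c' := by
  simpa [hi, Instr.isOutput] using
    step (M := M) (x := x) (c := c) (j := j) (by rw [hi]; rfl) (by rw [hi]; exact hj)
      (by rw [hi]; exact h)

/-- A run, described by the sequence of configurations of the machine. -/
theorem spec {c c' : Config} {t k : ℕ} {L : List Word} (h : Runs M x c t L k c') :
    ∀ s, M.conf x s = c →
      M.conf x (s + t) = c' ∧
      (∀ r, s ≤ r → r < s + t → (M.instrAt x r).isHalt = false) ∧
      ((List.range' s t).filter (fun r => (M.instrAt x r).isOutput)).map
        (fun r => (M.conf x r).word) = L ∧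
      ∑ r ∈ Finset.Ico s (s + t), (M.instrAt x r).cost (M.conf x r) ≤ k := by
  induction h with
  | refl c k => intro s hs; simp [hs]; intro r h1 h2; omega
  | @step c t L k j c' hh hc h ih =>
    intro s hs
    have hs' : M.conf x (s + 1) = (M.fetch c).exec x c := by
      rw [Machine.conf, Function.iterate_succ_apply']
      change (M.fetch (M.conf x s)).exec x (M.conf x s) = _
      rw [hs]
    have hi : M.instrAt x s = M.fetch c := by rw [Machine.instrAt, hs]
    obtain ⟨h1, h2, h3, h4⟩ := ih (s + 1) hs'
    have e : s + 1 + t = s + (t + 1) := by omega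
    rw [e] at h1 h2 h4
    refine ⟨h1, fun r hr hr' => ?_, ?_, ?_⟩
    · rcases hr.eq_or_lt with rfl | hr
      · rw [hi]; exact hh
      · exact h2 r hr hr'
    · rw [List.range'_succ, ← h3]
      cases ho : (M.fetch c).isOutput <;> simp [hi, ho, hs]
    · rw [Finset.sum_eq_sum_Ico_succ_bot (by omega), hi, hs]
      exact Nat.add_le_add hc h4

/-- `T` sums costs over a subset of the executed steps, so the cost of the whole run bounds it for
every `m`. -/
theorem halts {c' : Config} {t k : ℕ} {L : List Word} (h : Runs M x Config.init t L k c')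
    (hc : (M.fetch c').isHalt = true) :
    M.Halts x ∧ M.runLength x = t ∧ M.conf x t = c' ∧ M.outputs x = L ∧ ∀ m, M.T x m ≤ k := by
  obtain ⟨h1, h2, h3, h4⟩ := h.spec 0 rfl
  rw [Nat.zero_add] at h1 h2 h4
  have ht : (M.instrAt x t).isHalt = true := by rw [Machine.instrAt, h1]; exact hc
  have hr : M.runLength x = t := by
    refine le_antisymm (Nat.sInf_le ht) (le_csInf ⟨t, ht⟩ fun r hr => ?_)
    by_contra hlt
    have := h2 r (Nat.zero_le _) (not_le.mp hlt)
    rw [Set.mem_ofPred_eq, this] at hr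
    exact Bool.false_ne_true hr
  refine ⟨⟨t, ht⟩, hr, h1, ?_, fun m => ?_⟩
  · rw [Machine.outputs, hr, List.range_eq_range']; exact h3
  · rw [← Finset.range_eq_Ico] at h4
    rw [Machine.T, hr]
    split_ifs
    · exact h4
    · exact (Finset.sum_le_sum_of_subset (Finset.filter_subset _ _)).trans h4

end Runs

/-! ### Lower bound for the cost of the first output -/

namespace Machine

/-- All output registers start blank, and a step changes at most one of them. -/
theorem out_card_le (M : Machine) (x : Word) (t : ℕ) :
    ∃ s : Finset ℕ, s.card ≤ t ∧ ∀ i, (M.conf x t).out i ≠ none → i ∈ s := by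
  induction t with
  | zero => exact ⟨∅, le_rfl, fun i h => absurd rfl h⟩
  | succ t ih =>
    obtain ⟨s, hs, h⟩ := ih
    have key : ∃ a, ∀ i, i ≠ a → (M.conf x (t + 1)).out i = (M.conf x t).out i := by
      rw [Machine.conf, Function.iterate_succ_apply']
      change ∃ a, ∀ i, i ≠ a → ((M.fetch (M.conf x t)).exec x (M.conf x t)).out i = _
      cases M.fetch (M.conf x t) with
      | write a s =>
        exact ⟨((M.conf x t).reg a).toNat, fun i hi => by simp [Instr.exec, hi]⟩
      | _ => exact ⟨0, fun i _ => rfl⟩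
    obtain ⟨a, ha⟩ := key
    refine ⟨insert a s, (Finset.card_insert_le a s).trans (by omega), fun i hi => ?_⟩
    by_cases hia : i = a
    · simp [hia]
    · rw [ha i hia] at hi
      exact Finset.mem_insert_of_mem (h i hi)

/-- One step writes at most one letter. -/
theorem length_word_le (M : Machine) (x : Word) (t : ℕ) : (M.conf x t).word.length ≤ t := by
  obtain ⟨s, hs, h⟩ := M.out_card_le x t
  have h1 : (M.conf x t).word.length ≤ sInf {i : ℕ | (M.conf x t).out i = none} := by
    simpa [Config.word] using List.length_filterMap_le (M.conf x t).out
      (List.range (sInf {i : ℕ | (M.conf x t).out i = none}))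
  -- Every register before the first blank is nonblank, so it is among the at most `t` registers in
  -- `s`.
  have h2 : Finset.range (sInf {i : ℕ | (M.conf x t).out i = none}) ⊆ s := fun i hi =>
    h i (Nat.notMem_of_lt_sInf (Finset.mem_range.mp hi))
  simpa using h1.trans ((by simpa using Finset.card_le_card h2 : _ ≤ s.card).trans hs)

theorem one_le_cost {c : Config} {i : Instr} (h : i.isHalt = false) : 1 ≤ i.cost c := by
  cases i <;> simp_all [Instr.cost, Instr.isHalt] <;> omega

/-- The first output cannot be produced faster than its letters are written. -/
theorem le_T_one (M : Machine) (x : Word) (l : ℕ) (hne : M.outputs x ≠ [])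
    (hl : ∀ y ∈ M.outputs x, l ≤ y.length) : l ≤ M.T x 1 := by
  have hex : ∃ t, t < M.runLength x ∧ (M.instrAt x t).isOutput = true := by
    by_contra hcon
    push Not at hcon
    apply hne
    rw [Machine.outputs, List.map_eq_nil_iff, List.filter_eq_nil_iff]
    exact fun t ht => hcon t (List.mem_range.mp ht)
  classical
  obtain ⟨ht, ho⟩ := Nat.find_spec hex
  -- `t` is the step of the first output; all earlier steps count towards `T` at 1.
  have hmin := fun r (hr : r < Nat.find hex) => Nat.find_min hex hr
  set t := Nat.find hex
  have hw : l ≤ t := by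
    refine (hl _ ?_).trans (M.length_word_le x t)
    rw [Machine.outputs, List.mem_map]
    exact ⟨t, List.mem_filter.mpr ⟨List.mem_range.mpr ht, ho⟩, rfl⟩
  have hsub : Finset.range t ⊆
      (Finset.range (M.runLength x)).filter (fun t => M.numOutputs x (t + 1) < 1) := by
    intro r hr
    rw [Finset.mem_range] at hr
    rw [Finset.mem_filter, Finset.mem_range]
    refine ⟨hr.trans ht, ?_⟩
    rw [Nat.lt_one_iff, Machine.numOutputs, Nat.count_eq_card_filter_range, Finset.card_eq_zero,
      Finset.filter_eq_empty_iff]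
    intro s hs hso
    rw [Finset.mem_range] at hs
    exact hmin s (by omega) ⟨by omega, hso⟩
  rw [Machine.T, if_neg hne]
  calc l ≤ t := hw
    _ = ∑ _r ∈ Finset.range t, 1 := by simp
    _ ≤ ∑ r ∈ Finset.range t, (M.instrAt x r).cost (M.conf x r) := by
      refine Finset.sum_le_sum fun r hr => one_le_cost ?_
      have := Nat.notMem_of_lt_sInf ((Finset.mem_range.mp hr).trans ht)
      simpa using this
    _ ≤ _ := Finset.sum_le_sum_of_subset hsub

end Machine

/-! ### The separating problem and its machine -/

/-- The words `1^(2^n + j)` for `j < 2^n`, where `n` is the length of the input. -/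
def longUnary : EnumProblem := fun x =>
  {y | ∃ j < 2 ^ x.length, y = List.replicate (2 ^ x.length + j) Letter.one}

/-- A machine that solves `longUnary`. -/
def longUnaryMachine : Machine :=
  [.const 1 1, .const 2 1, .const 4 3,
    -- Scan the input with counter `R_0`, doubling `R_1` per letter; `R_4 = 3` is the code of the
    -- blank.
    .read 3 0, .sub 3 3 4, .jumpZero 3 9, .add 1 1 1, .add 0 0 2, .jump 3,
    .const 0 0,
    -- Write `R_1 = 2^n` ones; `R_2 = 1` serves both as increment and as code of the letter.
    .write 0 2, .add 0 0 2, .sub 3 1 0, .jumpPos 3 10,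
    .add 5 1 1,
    -- The test precedes `output`, so the longest word is left to the final instruction, after which
    -- the program ends at once.
    .add 0 0 2, .sub 3 5 0, .jumpZero 3 22, .output, .sub 3 0 2, .write 3 2, .jump 15,
    .output]

/-- Output registers that hold `1^l`. -/
def ones (l : ℕ) : ℕ → Option Letter := fun i => if i < l then some Letter.one else none

theorem update_ones (l : ℕ) : Function.update (ones l) l (some Letter.one) = ones (l + 1) := by
  funext i
  simp only [Function.update_apply, ones]
  split_ifs <;> first | rfl | omega

theorem word_ones (pc : ℕ) (r : ℕ → ℤ) (l : ℕ) :
    Config.word ⟨pc, r, ones l⟩ = List.replicate l Letter.one := by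
  have h : sInf {i : ℕ | ones l i = none} = l := by
    refine le_antisymm (Nat.sInf_le (by simp [ones])) (le_csInf ⟨l, by simp [ones]⟩ fun i hi => ?_)
    by_contra hlt
    simp only [Set.mem_ofPred_eq, ones, if_pos (not_le.mp hlt)] at hi
    exact Option.some_ne_none _ hi
  rw [Config.word]
  simp only [h]
  rw [List.filterMap_congr (g := fun _ => some Letter.one)
    (fun i hi => by simp [ones, List.mem_range.mp hi])]
  rw [List.eq_replicate_iff]
  simp

/-- Work registers that hold `a₀, …, a₅, 0, 0, …`. -/
def regs (a₀ a₁ a₂ a₃ a₄ a₅ : ℤ) : ℕ → ℤ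
  | 0 => a₀
  | 1 => a₁
  | 2 => a₂
  | 3 => a₃
  | 4 => a₄
  | 5 => a₅
  | _ => 0

section

variable (a₀ a₁ a₂ a₃ a₄ a₅ z : ℤ)

@[simp] theorem update_regs_zero :
    Function.update (regs a₀ a₁ a₂ a₃ a₄ a₅) 0 z = regs z a₁ a₂ a₃ a₄ a₅ := by
  funext i; rcases i with _ | _ | _ | _ | _ | _ | i <;> simp [regs, Function.update]

@[simp] theorem update_regs_one :
    Function.update (regs a₀ a₁ a₂ a₃ a₄ a₅) 1 z = regs a₀ z a₂ a₃ a₄ a₅ := by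
  funext i; rcases i with _ | _ | _ | _ | _ | _ | i <;> simp [regs, Function.update]

@[simp] theorem update_regs_two :
    Function.update (regs a₀ a₁ a₂ a₃ a₄ a₅) 2 z = regs a₀ a₁ z a₃ a₄ a₅ := by
  funext i; rcases i with _ | _ | _ | _ | _ | _ | i <;> simp [regs, Function.update]

@[simp] theorem update_regs_three :
    Function.update (regs a₀ a₁ a₂ a₃ a₄ a₅) 3 z = regs a₀ a₁ a₂ z a₄ a₅ := by
  funext i; rcases i with _ | _ | _ | _ | _ | _ | i <;> simp [regs, Function.update]

@[simp] theorem update_regs_four :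
    Function.update (regs a₀ a₁ a₂ a₃ a₄ a₅) 4 z = regs a₀ a₁ a₂ a₃ z a₅ := by
  funext i; rcases i with _ | _ | _ | _ | _ | _ | i <;> simp [regs, Function.update]

@[simp] theorem update_regs_five :
    Function.update (regs a₀ a₁ a₂ a₃ a₄ a₅) 5 z = regs a₀ a₁ a₂ a₃ a₄ z := by
  funext i; rcases i with _ | _ | _ | _ | _ | _ | i <;> simp [regs, Function.update]

end

/-! ### Cost of the three loops -/

variable (x : Word)

/-- The bound `3 * 2^n < 2^(n+2)` covers both `2 * 2^n` and, even for `n = 0`, the blank code 3. -/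
theorem cost_le {a b : ℤ} {n : ℕ} (ha : |a| ≤ 3 * 2 ^ n) (hb : |b| ≤ 3 * 2 ^ n) :
    1 + bitSize a + bitSize b ≤ 2 * n + 5 := by
  have h : ∀ z : ℤ, |z| ≤ 3 * 2 ^ n → bitSize z ≤ n + 2 := fun z hz => by
    refine Nat.size_le.mpr ?_
    have h1 : (0 : ℤ) < 2 ^ n := by positivity
    zify
    rw [pow_add]
    linarith
  have := h a ha
  have := h b hb
  omega

/-- Induction on the number `k` of unread letters: six instructions per letter and three to leave.
The scratch value `b` in `R_3` is arbitrary so that the induction closes. -/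
theorem runs_doubling (o : ℕ → Option Letter) (k : ℕ) : ∀ (i : ℕ) (b : ℤ), i + k = x.length →
    ∃ t, Runs longUnaryMachine x ⟨3, regs i (2 ^ i) 1 b 3 0, o⟩ t []
      ((6 * k + 3) * (2 * x.length + 5)) ⟨9, regs x.length (2 ^ x.length) 1 0 3 0, o⟩ := by
  have h1 : (0 : ℤ) < 2 ^ x.length := by positivity
  induction k with
  | zero =>
    intro i b hi
    obtain rfl : i = x.length := hi
    refine ⟨_, .mono (.silent (.read 3 0) (d := ⟨4, regs x.length (2 ^ x.length) 1 3 3 0, o⟩)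
        rfl rfl rfl le_rfl (by simp [Instr.exec, Config.assign, regs, encode]) <|
      .silent (j := 2 * x.length + 5) (.sub 3 3 4) rfl rfl rfl
        (d := ⟨5, regs x.length (2 ^ x.length) 1 0 3 0, o⟩) ?_ ?_ <|
      .silent (.jumpZero 3 9) rfl rfl rfl le_rfl rfl <| .refl _ 0) ?_⟩
    · apply cost_le <;> norm_num [regs] <;> linarith
    · simp [Instr.exec, Config.assign, regs]
    · simp only [Instr.cost]; linarith
  | succ k ih =>
    intro i b hi
    -- Inside the input the code is never 3, so the exit test fails.
    obtain ⟨z, hz, hb⟩ : ∃ z : ℤ, encode x[i]? = z ∧ (z = 0 ∨ z = 1 ∨ z = 2) := by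
      rw [List.getElem?_eq_getElem (by omega)]
      cases x[i]'(by omega) <;> simp [encode]
    obtain ⟨t, ht⟩ := ih (i + 1) (z - 3) (by omega)
    have h2 : (2 : ℤ) ^ i ≤ 2 ^ x.length := pow_le_pow_right₀ (by norm_num) (by omega)
    have h3 : (0 : ℤ) < 2 ^ i := by positivity
    have h4 : (i : ℤ) ≤ 2 ^ x.length := by
      exact_mod_cast (show i ≤ x.length by omega).trans x.length.lt_two_pow_self.le
    refine ⟨_, .mono (.silent (.read 3 0) (d := ⟨4, regs i (2 ^ i) 1 z 3 0, o⟩)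
        rfl rfl rfl le_rfl (by simp [Instr.exec, Config.assign, regs, hz]) <|
      .silent (j := 2 * x.length + 5) (.sub 3 3 4) rfl rfl rfl
        (d := ⟨5, regs i (2 ^ i) 1 (z - 3) 3 0, o⟩) ?_ ?_ <|
      .silent (.jumpZero 3 9) rfl rfl rfl le_rfl (d := ⟨6, regs i (2 ^ i) 1 (z - 3) 3 0, o⟩) ?_ <|
      .silent (j := 2 * x.length + 5) (.add 1 1 1) rfl rfl rfl
        (d := ⟨7, regs i (2 ^ (i + 1)) 1 (z - 3) 3 0, o⟩) ?_ ?_ <|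
      .silent (j := 2 * x.length + 5) (.add 0 0 2) rfl rfl rfl
        (d := ⟨8, regs (i + 1 : ℕ) (2 ^ (i + 1)) 1 (z - 3) 3 0, o⟩) ?_ ?_ <|
      .silent (.jump 3) rfl rfl rfl le_rfl rfl ht) ?_⟩
    · apply cost_le
      · simp only [regs]; rcases hb with rfl | rfl | rfl <;> norm_num <;> linarith
      · norm_num [regs]; linarith
    · simp [Instr.exec, Config.assign, regs]
    · simp only [Instr.exec, regs]
      rw [if_neg (by omega)]
    · apply cost_le <;> simp only [regs] <;> rw [abs_of_pos h3] <;> linarith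
    · simp [Instr.exec, Config.assign, regs, pow_succ, mul_two]
    · apply cost_le <;> simp only [regs] <;> norm_num <;> linarith
    · simp [Instr.exec, Config.assign, regs]
    · simp only [Instr.cost]; nlinarith

/-- The loop tests at its end, so at least one letter is written; hence `k + 1`. -/
theorem runs_writing (k : ℕ) : ∀ (i : ℕ) (b : ℤ), i + (k + 1) = 2 ^ x.length →
    ∃ t, Runs longUnaryMachine x ⟨10, regs i (2 ^ x.length) 1 b 3 0, ones i⟩ t []
      (4 * (k + 1) * (2 * x.length + 5))
      ⟨14, regs (2 ^ x.length) (2 ^ x.length) 1 0 3 0, ones (2 ^ x.length)⟩ := by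
  have h1 : (0 : ℤ) < 2 ^ x.length := by positivity
  have body : ∀ (i : ℕ) (b : ℤ), i < 2 ^ x.length → ∀ (t k : ℕ) (c : Config),
      Runs longUnaryMachine x ⟨13, regs (i + 1 : ℕ) (2 ^ x.length) 1 (2 ^ x.length - (i + 1 : ℕ)) 3 0,
        ones (i + 1)⟩ t [] k c →
      Runs longUnaryMachine x ⟨10, regs i (2 ^ x.length) 1 b 3 0, ones i⟩ (t + 3) []
        (k + 3 * (2 * x.length + 5)) c := by
    intro i b hi t k c h
    have hi' : (i : ℤ) + 1 ≤ 2 ^ x.length := by exact_mod_cast hi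
    refine .mono (.silent (.write 0 2) rfl rfl rfl le_rfl
        (d := ⟨11, regs i (2 ^ x.length) 1 b 3 0, ones (i + 1)⟩) ?_ <|
      .silent (j := 2 * x.length + 5) (.add 0 0 2) rfl rfl rfl
        (d := ⟨12, regs (i + 1 : ℕ) (2 ^ x.length) 1 b 3 0, ones (i + 1)⟩) ?_ ?_ <|
      .silent (j := 2 * x.length + 5) (.sub 3 1 0) rfl rfl rfl ?_ ?_ h) ?_
    · simp [Instr.exec, regs, decode, update_ones]
    · apply cost_le <;> simp only [regs] <;> norm_num <;> linarith
    · simp [Instr.exec, Config.assign, regs]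
    · apply cost_le <;> simp only [regs]
      · rw [abs_of_pos h1]; linarith
      · rw [abs_of_nonneg (by positivity)]; push_cast; linarith
    · simp [Instr.exec, Config.assign, regs]
    · simp only [Instr.cost]; linarith
  induction k with
  | zero =>
    intro i b hi
    have hi' : ((i + 1 : ℕ) : ℤ) = 2 ^ x.length := by rw [Nat.zero_add] at hi; exact_mod_cast hi
    refine ⟨_, .mono (body i b (by omega) _ _ _ <|
      .silent (.jumpPos 3 10) rfl rfl rfl le_rfl
        (d := ⟨14, regs (2 ^ x.length) (2 ^ x.length) 1 0 3 0, ones (2 ^ x.length)⟩) ?_ <|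
      .refl _ 0) ?_⟩
    · simp only [Instr.exec, regs]
      rw [if_neg (by omega), hi', sub_self, show i + 1 = 2 ^ x.length by omega]
    · simp only [Instr.cost]; linarith
  | succ k ih =>
    intro i b hi
    have hi' : ((i + 1 : ℕ) : ℤ) < 2 ^ x.length := by
      exact_mod_cast (show i + 1 < 2 ^ x.length by omega)
    obtain ⟨t, ht⟩ := ih (i + 1) (2 ^ x.length - (i + 1 : ℕ)) (by omega)
    refine ⟨_, .mono (body i b (by omega) _ _ _ <|
      .silent (.jumpPos 3 10) rfl rfl rfl le_rfl ?_ ht) ?_⟩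
    · simp only [Instr.exec, regs]
      rw [if_pos (by omega)]
    · simp only [Instr.cost]; linarith

/-- Seven instructions per produced word, three to leave. The run stops just before the last
`output`, with the longest word still unproduced. -/
theorem runs_listing (k : ℕ) : ∀ (i : ℕ) (b : ℤ), i + (k + 1) = 2 * 2 ^ x.length →
    ∃ t c, Runs longUnaryMachine x ⟨15, regs i (2 ^ x.length) 1 b 3 (2 * 2 ^ x.length), ones i⟩ t
      ((List.range' i k).map fun l => List.replicate l Letter.one)
      ((7 * k + 3) * (2 * x.length + 5)) c ∧
      c.pc = 22 ∧ c.word = List.replicate (i + k) Letter.one := by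
  have h1 : (0 : ℤ) < 2 ^ x.length := by positivity
  have body : ∀ (i : ℕ) (b : ℤ), i < 2 * 2 ^ x.length → ∀ (t k : ℕ) (c : Config) (L : List Word),
      Runs longUnaryMachine x ⟨17, regs (i + 1 : ℕ) (2 ^ x.length) 1 (2 * 2 ^ x.length - (i + 1 : ℕ)) 3
        (2 * 2 ^ x.length), ones i⟩ t L k c →
      Runs longUnaryMachine x ⟨15, regs i (2 ^ x.length) 1 b 3 (2 * 2 ^ x.length), ones i⟩ (t + 2) L
        (k + 2 * (2 * x.length + 5)) c := by
    intro i b hi t k c L h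
    have hi' : (i : ℤ) + 1 ≤ 2 * 2 ^ x.length := by exact_mod_cast hi
    refine .mono (
      .silent (j := 2 * x.length + 5) (.add 0 0 2) rfl rfl rfl
        (d := ⟨16, regs (i + 1 : ℕ) (2 ^ x.length) 1 b 3 (2 * 2 ^ x.length), ones i⟩) ?_ ?_ <|
      .silent (j := 2 * x.length + 5) (.sub 3 5 0) rfl rfl rfl ?_ ?_ h) ?_
    · apply cost_le <;> simp only [regs] <;> norm_num <;> linarith
    · simp [Instr.exec, Config.assign, regs]
    · apply cost_le <;> simp only [regs]
      · rw [abs_of_pos (by positivity)]; linarith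
      · rw [abs_of_nonneg (by positivity)]; push_cast; linarith
    · simp [Instr.exec, Config.assign, regs]
    · linarith
  induction k with
  | zero =>
    intro i b hi
    have hi' : ((i + 1 : ℕ) : ℤ) = 2 * 2 ^ x.length := by
      rw [Nat.zero_add] at hi; exact_mod_cast hi
    refine ⟨_, ⟨22, regs (i + 1 : ℕ) (2 ^ x.length) 1 (2 * 2 ^ x.length - (i + 1 : ℕ)) 3
      (2 * 2 ^ x.length), ones i⟩, .mono (body i b (by omega) _ _ _ _ <|
      .silent (.jumpZero 3 22) rfl rfl rfl le_rfl ?_ <| .refl _ 0) ?_, rfl, word_ones _ _ _⟩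
    · simp only [Instr.exec, regs]
      rw [if_pos (by omega)]
    · simp only [Instr.cost]; linarith
  | succ k ih =>
    intro i b hi
    have hi' : ((i + 1 : ℕ) : ℤ) < 2 * 2 ^ x.length := by
      exact_mod_cast (show i + 1 < 2 * 2 ^ x.length by omega)
    -- On re-entry `R_3` holds `i`, the address where the new letter was written.
    obtain ⟨t, c, ht, hc, hw⟩ := ih (i + 1) i (by omega)
    have hout := Runs.produce (M := longUnaryMachine)
      (c := ⟨18, regs (i + 1 : ℕ) (2 ^ x.length) 1 (2 * 2 ^ x.length - (i + 1 : ℕ)) 3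
        (2 * 2 ^ x.length), ones i⟩) rfl le_rfl <|
      .silent (j := 2 * x.length + 5) (.sub 3 0 2) rfl rfl rfl
        (d := ⟨20, regs (i + 1 : ℕ) (2 ^ x.length) 1 i 3 (2 * 2 ^ x.length), ones i⟩)
        (by
          apply cost_le <;> simp only [regs]
          · rw [abs_of_nonneg (by positivity)]; linarith
          · norm_num; linarith)
        (by simp [Instr.exec, Config.assign, regs]) <|
      .silent (.write 3 2) rfl rfl rfl le_rfl
        (d := ⟨21, regs (i + 1 : ℕ) (2 ^ x.length) 1 i 3 (2 * 2 ^ x.length), ones (i + 1)⟩)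
        (by simp [Instr.exec, regs, decode, update_ones]) <|
      .silent (.jump 15) rfl rfl rfl le_rfl rfl ht
    rw [word_ones] at hout
    rw [List.range'_succ, List.map_cons]
    refine ⟨_, c, .mono (body i b (by omega) _ _ _ _ <|
      .silent (.jumpZero 3 22) rfl rfl rfl le_rfl ?_ hout) ?_, hc, by rw [hw]; congr 1; omega⟩
    · simp only [Instr.exec, regs]
      rw [if_neg (by omega)]
    · simp only [Instr.cost]; linarith

theorem longUnaryMachine_spec (x : Word) :
    longUnaryMachine.Halts x ∧
    longUnaryMachine.outputs x =
      (List.range' (2 ^ x.length) (2 ^ x.length)).map (fun l => List.replicate l Letter.one) ∧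
    (longUnaryMachine.instrAt x (longUnaryMachine.runLength x - 1)).isOutput = true ∧
    ∀ m, longUnaryMachine.T x m ≤ (6 * x.length + 11 * 2 ^ x.length + 20) * (2 * x.length + 5) := by
  obtain ⟨k, hk⟩ : ∃ k, k + 1 = 2 ^ x.length := ⟨_, Nat.sub_add_cancel Nat.one_le_two_pow⟩
  obtain ⟨t₁, h₁⟩ := runs_doubling x (ones 0) x.length 0 0 (Nat.zero_add _)
  obtain ⟨t₂, h₂⟩ := runs_writing x k 0 0 (by omega)
  obtain ⟨t₃, c, h₃, hc, hw⟩ := runs_listing x k (2 ^ x.length) 0 (by omega)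
  have h1 : (0 : ℤ) < 2 ^ x.length := by positivity
  have hinit : Config.init = ⟨0, regs 0 0 0 0 0 0, ones 0⟩ := by
    rw [Config.init, Config.mk.injEq]
    refine ⟨rfl, funext fun i => ?_, funext fun i => by simp [ones]⟩
    rcases i with _ | _ | _ | _ | _ | _ | i <;> rfl
  have hA : Runs longUnaryMachine x Config.init (t₁ + 1 + 1 + 1) []
      (1 + (1 + (1 + (6 * x.length + 3) * (2 * x.length + 5))))
      ⟨9, regs x.length (2 ^ x.length) 1 0 3 0, ones 0⟩ := by
    rw [hinit]
    exact .silent (.const 1 1) rfl rfl rfl le_rfl (d := ⟨1, regs 0 1 0 0 0 0, ones 0⟩)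
        (by simp [Instr.exec, Config.assign]) <|
      .silent (.const 2 1) rfl rfl rfl le_rfl (d := ⟨2, regs 0 1 1 0 0 0, ones 0⟩)
        (by simp [Instr.exec, Config.assign]) <|
      .silent (.const 4 3) rfl rfl rfl le_rfl
        (by simp [Instr.exec, Config.assign]) h₁
  have hB := Runs.silent (M := longUnaryMachine) (x := x)
    (c := ⟨9, regs x.length (2 ^ x.length) 1 0 3 0, ones 0⟩) (j := 1) (.const 0 0) rfl rfl rfl
    le_rfl (by simp [Instr.exec, Config.assign]) h₂
  have hC := Runs.silent (M := longUnaryMachine) (x := x)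
    (c := ⟨14, regs (2 ^ x.length) (2 ^ x.length) 1 0 3 0, ones (2 ^ x.length)⟩)
    (j := 2 * x.length + 5) (.add 5 1 1) rfl rfl rfl
    (by apply cost_le <;> simp only [regs] <;> rw [abs_of_pos h1] <;> linarith)
    (by simp [Instr.exec, Config.assign, regs, two_mul]) h₃
  -- Program counter 23 lies outside the program, which means `halt`.
  have hD : Runs longUnaryMachine x c 1 [c.word] 1 { c with pc := 23 } := by
    have hf : longUnaryMachine.fetch c = .output := by rw [Machine.fetch, hc]; rfl
    have := Runs.produce (x := x) hf le_rfl (.refl _ 0)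
    rwa [hc] at this
  obtain ⟨hh, hr, -, ho, hT⟩ := (((hA.trans hB).trans hC).trans hD).halts rfl
  have hlast := ((hA.trans hB).trans hC).spec 0 rfl
  refine ⟨hh, ?_, ?_, fun m => (hT m).trans ?_⟩
  · rw [ho, hw, ← hk, List.range'_concat]
    simp
  · rw [hr, Nat.add_sub_cancel, Machine.instrAt, ← Nat.zero_add (_ + _), hlast.1, Machine.fetch, hc]
    rfl
  · have : k < 2 ^ x.length := by omega
    nlinarith

/-! ### Membership in output polynomial time -/

theorem longUnary_eq_image (x : Word) : longUnary x =
    (fun j => List.replicate (2 ^ x.length + j) Letter.one) '' ↑(Finset.range (2 ^ x.length)) := by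
  ext y
  simp [longUnary, eq_comm]

theorem longUnary_mem_enumF : longUnary ∈ EnumF := fun x => by
  rw [longUnary_eq_image]
  exact (Finset.finite_toSet _).image _

theorem ncard_longUnary (x : Word) : (longUnary x).ncard = 2 ^ x.length := by
  rw [longUnary_eq_image, Set.ncard_image_of_injective, Set.ncard_coe_finset, Finset.card_range]
  intro i j h
  simpa using congrArg List.length h

theorem longUnaryMachine_solves : Solves longUnaryMachine longUnary := fun x => by
  obtain ⟨hh, ho, hl, -⟩ := longUnaryMachine_spec x
  refine ⟨hh, ?_, ?_, fun _ => hl⟩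
  · rw [ho]
    refine List.Nodup.map (fun i j h => ?_) List.nodup_range'
    simpa using congrArg List.length h
  · ext y
    simp only [ho, longUnary, Set.mem_ofPred_eq, List.mem_map, List.mem_range'_1]
    constructor
    · rintro ⟨l, hl, rfl⟩
      exact ⟨l - 2 ^ x.length, by omega, by congr 1; omega⟩
    · rintro ⟨j, hj, rfl⟩
      exact ⟨2 ^ x.length + j, by omega, rfl⟩

theorem longUnary_mem_outputPF : longUnary ∈ OutputPF := by
  refine ⟨longUnary_mem_enumF, longUnaryMachine,
    (6 * .X 0 + 11 * .X 1 + 20) * (2 * .X 0 + 5) + 1, longUnaryMachine_solves, fun x => ?_⟩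
  have := (longUnaryMachine_spec x).2.2.2 (longUnary x).ncard
  rw [ncard_longUnary] at this ⊢
  simpa [Nat.lt_succ_iff] using this

/-! ### Failure of incremental polynomial time -/

/-- Powers of two outgrow every polynomial. -/
theorem exists_eval_lt_two_pow (q : Polynomial ℕ) : ∃ n : ℕ, q.eval n < 2 ^ n := by
  have h : (fun n : ℕ => ((q.eval n : ℕ) : ℝ)) =o[Filter.atTop] fun n : ℕ => (2 : ℝ) ^ n := by
    induction q using Polynomial.induction_on' with
    | add p q hp hq => simpa using hp.add hq
    | monomial k c =>
      simpa using (isLittleO_pow_const_const_pow_of_one_lt k one_lt_two).const_mul_left (c : ℝ)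
  obtain ⟨n, hn⟩ := (h.bound (by norm_num : (0 : ℝ) < 1 / 2)).exists
  refine ⟨n, ?_⟩
  rw [Real.norm_natCast, norm_pow, Real.norm_ofNat] at hn
  have : (0 : ℝ) < 2 ^ n := by positivity
  exact_mod_cast (show ((q.eval n : ℕ) : ℝ) < 2 ^ n by linarith)

theorem longUnary_notMem_incPF : longUnary ∉ IncPF := by
  intro h
  simp only [IncPF, Set.mem_iUnion] at h
  obtain ⟨a, -, -, M, q, b, c, hM, hT⟩ := h
  -- This polynomial is the incremental bound at `m = 1`, where `m^a = 1`.
  obtain ⟨n, hn⟩ := exists_eval_lt_two_pow (q + .C c * .X ^ b)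
  have hx : (List.replicate n Letter.one).length = n := List.length_replicate
  set x := List.replicate n Letter.one
  obtain ⟨-, -, ho, -⟩ := hM x
  have hmem : ∀ y, y ∈ M.outputs x ↔ y ∈ longUnary x := fun y => by rw [← ho]; rfl
  have h1 := hT x 1 (by rw [ncard_longUnary]; exact Nat.one_le_two_pow)
  have h2 : 2 ^ x.length ≤ M.T x 1 := by
    refine M.le_T_one x _ (List.ne_nil_of_mem ((hmem _).mpr ⟨0, by positivity, rfl⟩)) fun y hy => ?_
    obtain ⟨j, -, rfl⟩ := (hmem y).mp hy
    simp
  rw [hx] at h1 h2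
  simp at hn h1
  omega

end EnumRAM

theorem mainTheorem10 : EnumRAM.IncPF ≠ EnumRAM.OutputPF := fun h =>
  EnumRAM.longUnary_notMem_incPF (h ▸ EnumRAM.longUnary_mem_outputPF)
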